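/- Consider a network of $N$ nodes at distances $r_1,\dots,r_N\in(0,1]$ from a base station, where node $i$ transmits in each slot with probability $p_i$. Take roll-off parameter $\beta=2$ and capture threshold $\theta=1$, and put $d_{ij}=r_j^2/r_i^2$. The expected age of information of node $i$ is $$h_i(p,r)=\frac{1}{p_i\prod_{j\ne i}\bigl(1-\frac{p_j}{1+d_{ij}}\bigr)}\in[1,\infty].$$ The proportionally fair policy $p^{PF}=p^{PF}(r)$ is the minimizer of $\sum_{i=1}^N\log h_i(p,r)$ over $p\in[0,1]^N$. The topology-agnostic policy is $$p_i^{TA}=\frac{1}{(N-1)\bigl(1-r_i^2\log(1+1/r_i^2)\bigr)} .$$ **Theorem.** For every $N$ and every $r\in(0,1]^N$ the proportionally fair policy exists and is unique. Fix a distance $x\in(0,1]$. For $1\le i\le N$ let node $i$ have distance $r_i=x$, and let the other $N-1$ nodes be located independently and uniformly in the unit disc centred at the base station, so that $p_i^{PF}$ is a random variable and $p_i^{TA}$ is a constant. 1. For every $\varepsilon\in(0,1)$ there is a constant $k>0$, depending only on $x$ and $\varepsilon$, such that $$\lim_{N\to\infty}\mathbb P\Bigl[\,|p_i^{PF}-p_i^{TA}|\le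 \frac{k}{N^{3/2}}\Bigr]=1-\varepsilon ,$$ uniformly in $i\in\{1,\dots,N\}$. 2. For every $\varepsilon>0$ there are a constant $k>0$ and an $N_0$, depending only on $x$ and $\varepsilon$, such that for all $N\ge N_0$ and all $i\in\{1,\dots,N\}$ $$\mathbb P\Bigl[\,|p_i^{PF}-p_i^{TA}|\le \frac{k}{N^{3/2}}\Bigr]\ge 1-\varepsilon .$$ That is, with arbitrarily high probability the topology-agnostic policy converges to the proportionally fair one at rate $N^{-3/2}$. -/

import Mathlib

open MeasureTheory ProbabilityTheory

noncomputable section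

namespace SpatialAoI

/-- The ratio `d i j = r_j ^ β / (r_i ^ β * θ)` of received signal strengths, for roll-off
parameter `β`, capture threshold `θ` and position vector `r`. -/
def relDist (β θ : ℝ) {N : ℕ} (r : Fin N → ℝ) (i j : Fin N) : ℝ :=
  r j ^ β / (r i ^ β * θ)

/-- The success probability of node `i` in a slot when node `j` transmits with probability `p j`:
`p_i * ∏_{j ≠ i} (1 - p_j / (1 + d i j))`. -/
def successProb (β θ : ℝ) {N : ℕ} (r p : Fin N → ℝ) (i : Fin N) : ℝ :=
  p i * ∏ j ∈ Finset.univ.erase i, (1 - p j / (1 + relDist β θ r i j))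

/-- The expected age of information of node `i` as a function of positions and transmission
probabilities: `h_i = 1 / (p_i * ∏_{j ≠ i} (1 - p_j / (1 + d i j)))`. It takes the value `∞` when the success probability is `0`. -/
def age (β θ : ℝ) {N : ℕ} (r p : Fin N → ℝ) (i : Fin N) : ENNReal :=
  (ENNReal.ofReal (successProb β θ r p i))⁻¹

/-- The proportionally fair objective `∑ i, log h_i`, with `log ∞ = ∞`. All ages are at least `1`
for admissible `p`, so no term is `-∞`. -/
def pfObjective (β θ : ℝ) {N : ℕ} (r p : Fin N → ℝ) : EReal :=
  ∑ i, ENNReal.log (age β θ r p i)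

/-- `p` minimizes the sum of the logarithms of the ages over all vectors of transmission
probabilities `0 ≤ p_i ≤ 1`. -/
def IsProportionallyFair (β θ : ℝ) {N : ℕ} (r p : Fin N → ℝ) : Prop :=
  p ∈ Set.Icc (0 : Fin N → ℝ) 1 ∧ IsMinOn (pfObjective β θ r) (Set.Icc (0 : Fin N → ℝ) 1) p

/-- The proportionally fair policy for the position vector `r`. -/
def pfPolicy (β θ : ℝ) {N : ℕ} (r : Fin N → ℝ) : Fin N → ℝ :=
  Classical.epsilon (IsProportionallyFair β θ r)

/-- The topology-agnostic transmission probability (for `β = 2`, `θ = 1`) of a node at distance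
`x` from the base station in a network of `N` nodes. -/
def taProb (N : ℕ) (x : ℝ) : ℝ :=
  1 / (((N : ℝ) - 1) * (1 - x ^ 2 * Real.log (1 + 1 / x ^ 2)))

/-- The uniform distribution on the unit disc of the plane. -/
def uniformDisc : Measure (EuclideanSpace ℝ (Fin 2)) :=
  cond volume (Metric.closedBall 0 1)

/-- The law of the locations of `N` independent nodes, uniform on the unit disc. -/
def locationLaw (N : ℕ) : Measure (Fin N → EuclideanSpace ℝ (Fin 2)) :=
  Measure.pi fun _ => uniformDisc

/-- The position vector when the distance of node `i` is given to be `x` and every other node `j`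
is located at `y j`. -/
def positions {N : ℕ} (i : Fin N) (x : ℝ) (y : Fin N → EuclideanSpace ℝ (Fin 2)) : Fin N → ℝ :=
  Function.update (fun j => ‖y j‖) i x

/-- The probability, given that node `i` is at distance `x` from the base station and the other
`N - 1` nodes are independent and uniform on the disc, that
`|p_i^PF - p_i^TA| ≤ k / N ^ (3 / 2)`, for `β = 2` and `θ = 1`. -/
def closenessProb (N : ℕ) (i : Fin N) (x k : ℝ) : ℝ :=
  (locationLaw N).real
    {y | |pfPolicy 2 1 (positions i x y) i - taProb N x| ≤ k / (N : ℝ) ^ (3 / 2 : ℝ)}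

end SpatialAoI

end

open MeasureTheory ProbabilityTheory Filter Topology


namespace SpatialAoI

/-! Grouping the logarithms by transmitter, `-∑ log h_i` splits into one concave function `u_i` of
each `p_i` alone, namely `log t + ∑ log (1 - t / a_j)` with `a_j = 1 + d_ji` (`pfObjective_eq`). So
the minimizer is found coordinatewise, and it is unique by strict monotonicity of the slope.

The first-order condition reads `1 / q = ∑ 1 / (a_j - q)`, up to the boundary case `q = 1`. Its
right side is `S + O(n q)`, where `n = N - 1` and `S = ∑ 1 / a_j` is a sum of `n` iid terms `ρ² /
(ρ² + x²)` with mean `m = 1 - x² log (1 + 1/x²)`. Hence `p^TA = 1 / (n m)`, `q` has order `1 / n`,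
and `q - p^TA ≈ (n m - S) / (n m)²`. By the central limit theorem `S - n m` has order `√n`, which
gives the rate `N^(-3/2)`.

Thus closeness with constant `k` is sandwiched between the events `|S - n m| ≤ c √n` with `c`
slightly below and slightly above `m² k` (`eventually_policy_close`,
`eventually_interference_close`). The limit is the Gaussian mass of `[-m² k, m² k]`, and `k` is
chosen to make it `1 - ε`. -/

/-- The part of the negated proportionally fair objective that depends on the transmission
probability `t` of a single node: `log t + ∑ j ∈ s, log (1 - t / a j)`. -/
noncomputable def logUtility {ι : Type*} (s : Finset ι) (a : ι → ℝ) (t : ℝ) : ℝ :=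
  Real.log t + ∑ j ∈ s, Real.log (1 - t / a j)

/-! ### Maximizing the utility of a single node -/

section Utility

variable {ι : Type*} {s : Finset ι} {a : ι → ℝ} {q t : ℝ}

/-- The tangent-line inequality of a concave function, obtained term by term from `1 - 1 / y ≤ log
y`; the bracket is minus the derivative at `t`. -/
theorem mul_slope_le_logUtility_sub (ha : ∀ j ∈ s, 1 < a j) (hq : q ∈ Set.Ioc (0 : ℝ) 1)
    (ht : t ∈ Set.Ioc (0 : ℝ) 1) :
    (q - t) * (∑ j ∈ s, 1 / (a j - t) - 1 / t) ≤ logUtility s a t - logUtility s a q := by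
  obtain ⟨hq0, hq1⟩ := hq
  obtain ⟨ht0, ht1⟩ := ht
  have h1 : 1 - q / t ≤ Real.log t - Real.log q := by
    rw [← Real.log_div ht0.ne' hq0.ne']
    simpa using Real.one_sub_inv_le_log_of_pos (div_pos ht0 hq0)
  have h2 : ∀ j ∈ s, (q - t) * (1 / (a j - t)) ≤
      Real.log (1 - t / a j) - Real.log (1 - q / a j) := by
    intro j hj
    have haj := ha j hj
    have e1 : 1 - t / a j = (a j - t) / a j := by field_simp
    have e2 : 1 - q / a j = (a j - q) / a j := by field_simp
    have p1 : 0 < a j - t := by linarith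
    have p2 : 0 < a j - q := by linarith
    have p3 : 0 < a j := by linarith
    rw [e1, e2, Real.log_div p1.ne' p3.ne', Real.log_div p2.ne' p3.ne',
      sub_sub_sub_cancel_right, ← Real.log_div p1.ne' p2.ne']
    refine le_trans (le_of_eq ?_) (Real.one_sub_inv_le_log_of_pos (div_pos p1 p2))
    field_simp
    ring
  have h3 := Finset.sum_le_sum h2
  rw [← Finset.mul_sum, Finset.sum_sub_distrib] at h3
  have h4 : (q - t) * (1 / t) = -(1 - q / t) := by field_simp; ring
  unfold logUtility
  rw [mul_sub, h4]
  linarith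

/-- Compactness applies to the exponential of the utility, which is continuous on all of `[0, 1]`;
it vanishes at `0` and is positive at `1`, so the maximizer is not `0`. -/
theorem exists_isMaxOn_logUtility (ha : ∀ j ∈ s, 1 < a j) :
    ∃ q ∈ Set.Ioc (0 : ℝ) 1, IsMaxOn (logUtility s a) (Set.Ioc 0 1) q := by
  have hcont : Continuous fun t : ℝ => t * ∏ j ∈ s, (1 - t / a j) := by fun_prop
  have hpos : ∀ t ∈ Set.Ioc (0 : ℝ) 1, ∀ j ∈ s, 0 < 1 - t / a j := by
    intro t ht j hj
    have haj := ha j hj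
    rw [sub_pos, div_lt_one (by linarith)]
    linarith [ht.2]
  have hlog : ∀ t ∈ Set.Ioc (0 : ℝ) 1,
      logUtility s a t = Real.log (t * ∏ j ∈ s, (1 - t / a j)) := by
    intro t ht
    rw [Real.log_mul ht.1.ne' (Finset.prod_pos (hpos t ht)).ne',
      Real.log_prod fun j hj => (hpos t ht j hj).ne', logUtility]
  obtain ⟨q, hq, hmax⟩ := isCompact_Icc.exists_isMaxOn (Set.nonempty_Icc.2 zero_le_one)
    (hcont.continuousOn (s := Set.Icc (0 : ℝ) 1))
  have hone : (1 : ℝ) ∈ Set.Ioc (0 : ℝ) 1 := ⟨one_pos, le_rfl⟩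
  have hq0 : q ≠ 0 := by
    rintro rfl
    have h := hmax (Set.right_mem_Icc.2 (zero_le_one' ℝ))
    have h' := Finset.prod_pos (hpos 1 hone)
    simp only [Set.mem_ofPred_eq, one_mul, zero_mul] at h
    linarith
  have hq' : q ∈ Set.Ioc (0 : ℝ) 1 := ⟨lt_of_le_of_ne hq.1 hq0.symm, hq.2⟩
  refine ⟨q, hq', fun t ht => ?_⟩
  simp only [Set.mem_ofPred_eq]
  rw [hlog t ht, hlog q hq']
  exact Real.log_le_log (mul_pos ht.1 (Finset.prod_pos (hpos t ht)))
    (hmax (Set.Ioc_subset_Icc_self ht))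

theorem slope_le_of_lt (ha : ∀ j ∈ s, 1 < a j) (hq : q ∈ Set.Ioc (0 : ℝ) 1)
    (hmax : IsMaxOn (logUtility s a) (Set.Ioc 0 1) q) (ht : 0 < t) (htq : t < q) :
    ∑ j ∈ s, 1 / (a j - t) ≤ 1 / t := by
  have ht' : t ∈ Set.Ioc (0 : ℝ) 1 := ⟨ht, htq.le.trans hq.2⟩
  have h1 := mul_slope_le_logUtility_sub ha hq ht'
  have h2 : logUtility s a t ≤ logUtility s a q := hmax ht'
  by_contra! h
  have := mul_pos (sub_pos.2 htq) (sub_pos.2 h)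
  linarith

theorem le_slope_of_lt (ha : ∀ j ∈ s, 1 < a j) (hq : q ∈ Set.Ioc (0 : ℝ) 1)
    (hmax : IsMaxOn (logUtility s a) (Set.Ioc 0 1) q) (ht : t ≤ 1) (hqt : q < t) :
    1 / t ≤ ∑ j ∈ s, 1 / (a j - t) := by
  have ht' : t ∈ Set.Ioc (0 : ℝ) 1 := ⟨hq.1.trans hqt, ht⟩
  have h1 := mul_slope_le_logUtility_sub ha hq ht'
  have h2 : logUtility s a t ≤ logUtility s a q := hmax ht'
  by_contra! h
  have := mul_pos_of_neg_of_neg (sub_neg.2 hqt) (sub_neg.2 h)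
  linarith

/-- At `u < v` strictly between two maximizers, the slope conditions give `1 / u ≤ ∑ 1 / (a j - u) ≤
∑ 1 / (a j - v) ≤ 1 / v`, which is absurd. -/
theorem not_lt_of_isMaxOn_logUtility (ha : ∀ j ∈ s, 1 < a j) {q' : ℝ}
    (hq : q ∈ Set.Ioc (0 : ℝ) 1) (hmax : IsMaxOn (logUtility s a) (Set.Ioc 0 1) q)
    (hq' : q' ∈ Set.Ioc (0 : ℝ) 1) (hmaxr : IsMaxOn (logUtility s a) (Set.Ioc 0 1) q') :
    ¬ q < q' := by
  intro hlt
  obtain ⟨u, hu, huq⟩ := exists_between hlt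
  obtain ⟨v, hv, hvq⟩ := exists_between huq
  have hu0 := hq.1.trans hu
  have hq1 := hq'.2
  have h1 := le_slope_of_lt ha hq hmax (huq.le.trans hq'.2) hu
  have h2 := slope_le_of_lt ha hq' hmaxr (hu0.trans hv) hvq
  have h3 : ∑ j ∈ s, 1 / (a j - u) ≤ ∑ j ∈ s, 1 / (a j - v) := by
    refine Finset.sum_le_sum fun j hj => ?_
    have := ha j hj
    exact one_div_le_one_div_of_le (by linarith) (by linarith)
  have h4 := one_div_lt_one_div_of_lt hu0 hv
  linarith

theorem eq_of_isMaxOn_logUtility (ha : ∀ j ∈ s, 1 < a j) {q' : ℝ}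
    (hq : q ∈ Set.Ioc (0 : ℝ) 1) (hmax : IsMaxOn (logUtility s a) (Set.Ioc 0 1) q)
    (hq' : q' ∈ Set.Ioc (0 : ℝ) 1) (hmaxr : IsMaxOn (logUtility s a) (Set.Ioc 0 1) q') :
    q = q' :=
  le_antisymm (not_lt.1 (not_lt_of_isMaxOn_logUtility ha hq' hmaxr hq hmax))
    (not_lt.1 (not_lt_of_isMaxOn_logUtility ha hq hmax hq' hmaxr))

/-- The maximizer is at most the reciprocal of the total interference. -/
theorem mul_sum_le_one_of_isMaxOn (ha : ∀ j ∈ s, 1 < a j) (hq : q ∈ Set.Ioc (0 : ℝ) 1)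
    (hmax : IsMaxOn (logUtility s a) (Set.Ioc 0 1) q) : q * ∑ j ∈ s, 1 / a j ≤ 1 := by
  have hev : ∀ᶠ t in 𝓝[<] q, t * ∑ j ∈ s, 1 / a j ≤ 1 := by
    filter_upwards [Ioo_mem_nhdsLT hq.1] with t ht
    have h1 := slope_le_of_lt ha hq hmax ht.1 ht.2
    have h2 : ∑ j ∈ s, 1 / a j ≤ ∑ j ∈ s, 1 / (a j - t) := by
      refine Finset.sum_le_sum fun j hj => ?_
      have := ha j hj
      exact one_div_le_one_div_of_le (by linarith [ht.2, hq.2]) (by linarith [ht.1])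
    rw [← le_div_iff₀' ht.1]
    exact h2.trans h1
  have hlim : Tendsto (fun t : ℝ => t * ∑ j ∈ s, 1 / a j) (𝓝[<] q) (𝓝 (q * ∑ j ∈ s, 1 / a j)) :=
    ((continuous_id.mul continuous_const).tendsto q).mono_left nhdsWithin_le_nhds
  exact le_of_tendsto hlim hev

/-- A maximizer below `1` is at least the reciprocal of the total interference up to an error
controlled by the gap `c` between the parameters and `1`. -/
theorem one_div_le_of_isMaxOn {c : ℝ} (hc : 0 < c) (ha : ∀ j ∈ s, 1 + c ≤ a j)
    (hq : q ∈ Set.Ioc (0 : ℝ) 1) (hmax : IsMaxOn (logUtility s a) (Set.Ioc 0 1) q)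
    (hq1 : q < 1) : 1 / q ≤ ∑ j ∈ s, 1 / a j + s.card * q / c := by
  have ha' : ∀ j ∈ s, 1 < a j := fun j hj => by linarith [ha j hj]
  have hev : ∀ᶠ t in 𝓝[>] q, 1 / t ≤ ∑ j ∈ s, 1 / a j + s.card * t / c := by
    filter_upwards [Ioo_mem_nhdsGT hq1] with t ht
    have ht0 := hq.1.trans ht.1
    refine (le_slope_of_lt ha' hq hmax ht.2.le ht.1).trans ?_
    -- The exact error is `t / (a j * (a j - t))`, with `a j > 1` and `a j - t ≥ c` because `t ≤ 1`.
    have h2 : ∀ j ∈ s, 1 / (a j - t) ≤ 1 / a j + t / c := by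
      intro j hj
      have h := ha j hj
      have p1 : 0 < a j - t := by linarith [ht.2]
      have p2 : 1 < a j := ha' j hj
      have e : 1 / (a j - t) = 1 / a j + t / (a j * (a j - t)) := by
        field_simp
        ring
      rw [e]
      gcongr
      have p3 : c ≤ a j - t := by linarith [ht.2]
      nlinarith
    refine (Finset.sum_le_sum h2).trans (le_of_eq ?_)
    rw [Finset.sum_add_distrib, Finset.sum_const, nsmul_eq_mul, mul_div_assoc]
  have hl1 : Tendsto (fun t : ℝ => 1 / t) (𝓝[>] q) (𝓝 (1 / q)) :=
    (tendsto_const_nhds.div tendsto_id hq.1.ne').mono_left nhdsWithin_le_nhds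
  have hcont : Continuous fun t : ℝ => ∑ j ∈ s, 1 / a j + s.card * t / c := by fun_prop
  exact le_of_tendsto_of_tendsto hl1 ((hcont.tendsto q).mono_left nhdsWithin_le_nhds) hev

end Utility

/-! ### Decoupling of the objective; existence and uniqueness -/

section Objective

variable {β θ : ℝ} {N : ℕ} {r p : Fin N → ℝ}

theorem relDist_pos (hθ : 0 < θ) (hr : ∀ j, 0 < r j) (i j : Fin N) : 0 < relDist β θ r i j :=
  div_pos (Real.rpow_pos_of_pos (hr j) _) (mul_pos (Real.rpow_pos_of_pos (hr i) _) hθ)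

/-- The logarithmic utility of node `i`, interfering with every other node. -/
noncomputable def nodeUtility (β θ : ℝ) (r : Fin N → ℝ) (i : Fin N) : ℝ → ℝ :=
  logUtility (Finset.univ.erase i) fun j => 1 + relDist β θ r j i

theorem interference_factor_pos (hθ : 0 < θ) (hr : ∀ j, 0 < r j) {t : ℝ} (ht : t ≤ 1)
    (i j : Fin N) : 0 < 1 - t / (1 + relDist β θ r i j) := by
  have := relDist_pos (β := β) hθ hr i j
  rw [sub_pos, div_lt_one (by linarith)]
  linarith

theorem successProb_pos (hθ : 0 < θ) (hr : ∀ j, 0 < r j) (hp : ∀ i, p i ∈ Set.Ioc (0 : ℝ) 1)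
    (i : Fin N) : 0 < successProb β θ r p i :=
  mul_pos (hp i).1 (Finset.prod_pos fun j _ => interference_factor_pos hθ hr (hp j).2 i j)

theorem pfObjective_eq (hθ : 0 < θ) (hr : ∀ j, 0 < r j) (hp : ∀ i, p i ∈ Set.Ioc (0 : ℝ) 1) :
    pfObjective β θ r p = ((-∑ i, nodeUtility β θ r i (p i) : ℝ) : EReal) := by
  have h1 : ∀ i, ENNReal.log (age β θ r p i) =
      ((-Real.log (successProb β θ r p i) : ℝ) : EReal) := by
    intro i
    rw [age, ENNReal.log_inv, ENNReal.log_ofReal_of_pos (successProb_pos hθ hr hp i),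
      EReal.coe_neg]
  have h2 : ∀ i, Real.log (successProb β θ r p i) = Real.log (p i) +
      ∑ j ∈ Finset.univ.erase i, Real.log (1 - p j / (1 + relDist β θ r i j)) := by
    intro i
    have hf := fun j => interference_factor_pos (β := β) hθ hr (hp j).2 i j
    rw [successProb, Real.log_mul (hp i).1.ne' (Finset.prod_pos fun j _ => hf j).ne',
      Real.log_prod fun j _ => (hf j).ne']
  rw [pfObjective, Finset.sum_congr rfl fun i _ => h1 i]
  have h3 : ∀ f : Fin N → ℝ, ∑ i, ((f i : ℝ) : EReal) = ((∑ i, f i : ℝ) : EReal) := by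
    intro f
    exact (map_sum (⟨⟨Real.toEReal, EReal.coe_zero⟩, EReal.coe_add⟩ : ℝ →+ EReal) f _).symm
  rw [h3, Finset.sum_neg_distrib]
  congr 2
  simp only [h2, nodeUtility, logUtility, Finset.sum_add_distrib]
  congr 1
  -- Exchanging receiver and transmitter collects all the factors that contain the same `p j`.
  refine Finset.sum_comm' fun i j => ?_
  simp [ne_comm]

theorem pfObjective_eq_top {i : Fin N} (hi : p i = 0) :
    pfObjective β θ r p = ⊤ := by
  rw [pfObjective, ← Finset.add_sum_erase _ _ (Finset.mem_univ i)]
  have h1 : ENNReal.log (age β θ r p i) = ⊤ := by simp [age, successProb, hi]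
  -- In `EReal`, `⊤ + ⊥ = ⊥`, so the other terms have to be bounded away from `⊥`.
  rw [h1, EReal.top_add_of_ne_bot]
  refine (Finset.sum_induction _ (fun x : EReal => ⊥ < x) (fun a b ha hb => ?_) ?_ ?_).ne'
  · exact EReal.bot_lt_add_iff.2 ⟨ha, hb⟩
  · exact EReal.bot_lt_zero
  · intro j _
    simp [age]

/-- A separable sum over a box is minimized coordinatewise. Zero coordinates cost `⊤`, while the
all-ones vector has finite cost. -/
theorem isProportionallyFair_iff (hθ : 0 < θ) (hr : ∀ j, 0 < r j) :
    IsProportionallyFair β θ r p ↔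
      ∀ i, p i ∈ Set.Ioc (0 : ℝ) 1 ∧ IsMaxOn (nodeUtility β θ r i) (Set.Ioc 0 1) (p i) := by
  have hIcc : ∀ {p' : Fin N → ℝ}, (∀ i, p' i ∈ Set.Ioc (0 : ℝ) 1) →
      p' ∈ Set.Icc (0 : Fin N → ℝ) 1 :=
    fun h => ⟨fun i => (h i).1.le, fun i => (h i).2⟩
  constructor
  · rintro ⟨hp, hmin⟩
    have hone : ∀ i, (1 : Fin N → ℝ) i ∈ Set.Ioc (0 : ℝ) 1 := fun i => ⟨one_pos, le_rfl⟩
    have hpos : ∀ i, p i ∈ Set.Ioc (0 : ℝ) 1 := by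
      intro i
      refine ⟨lt_of_le_of_ne (hp.1 i) fun h => ?_, hp.2 i⟩
      have h1 : pfObjective β θ r p ≤ pfObjective β θ r 1 := hmin (hIcc hone)
      rw [pfObjective_eq_top h.symm, pfObjective_eq hθ hr hone] at h1
      exact EReal.coe_ne_top _ (top_le_iff.1 h1)
    refine fun i => ⟨hpos i, fun t ht => ?_⟩
    have hupd : ∀ j, Function.update p i t j ∈ Set.Ioc (0 : ℝ) 1 := by
      intro j
      rcases eq_or_ne j i with rfl | h
      · simpa using ht
      · simpa [h] using hpos j
    have h1 : pfObjective β θ r p ≤ pfObjective β θ r (Function.update p i t) := hmin (hIcc hupd)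
    rw [pfObjective_eq hθ hr hpos, pfObjective_eq hθ hr hupd, EReal.coe_le_coe_iff, neg_le_neg_iff,
      ← Finset.add_sum_erase _ _ (Finset.mem_univ i),
      ← Finset.add_sum_erase _ _ (Finset.mem_univ i)] at h1
    have h2 : ∑ j ∈ Finset.univ.erase i, nodeUtility β θ r j (Function.update p i t j) =
        ∑ j ∈ Finset.univ.erase i, nodeUtility β θ r j (p j) :=
      Finset.sum_congr rfl fun j hj => by rw [Function.update_of_ne (Finset.ne_of_mem_erase hj)]
    rw [h2, Function.update_self] at h1
    exact le_of_add_le_add_right h1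
  · intro h
    have hpos := fun i => (h i).1
    refine ⟨hIcc hpos, fun p' hp' => ?_⟩
    simp only [Set.mem_ofPred_eq]
    by_cases hz : ∃ i, p' i = 0
    · obtain ⟨i, hi⟩ := hz
      rw [pfObjective_eq_top hi]
      exact le_top
    · push Not at hz
      have hpos' : ∀ i, p' i ∈ Set.Ioc (0 : ℝ) 1 :=
        fun i => ⟨lt_of_le_of_ne (hp'.1 i) (hz i).symm, hp'.2 i⟩
      rw [pfObjective_eq hθ hr hpos, pfObjective_eq hθ hr hpos', EReal.coe_le_coe_iff,
        neg_le_neg_iff]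
      exact Finset.sum_le_sum fun i _ => (h i).2 (hpos' i)

theorem existsUnique_isProportionallyFair (hθ : 0 < θ) (hr : ∀ j, 0 < r j) :
    ∃! p, IsProportionallyFair β θ r p := by
  have ha : ∀ i, ∀ j ∈ Finset.univ.erase i, 1 < 1 + relDist β θ r j i :=
    fun i j _ => by linarith [relDist_pos (β := β) hθ hr j i]
  choose q hq hmax using fun i => exists_isMaxOn_logUtility (ha i)
  refine ⟨q, (isProportionallyFair_iff hθ hr).2 fun i => ⟨hq i, hmax i⟩, fun p hp => ?_⟩
  replace hp := (isProportionallyFair_iff hθ hr).1 hp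
  exact funext fun i => eq_of_isMaxOn_logUtility (ha i) (hp i).1 (hp i).2 (hq i) (hmax i)

theorem isProportionallyFair_pfPolicy (hθ : 0 < θ) (hr : ∀ j, 0 < r j) :
    IsProportionallyFair β θ r (pfPolicy β θ r) :=
  Classical.epsilon_spec (existsUnique_isProportionallyFair hθ hr).exists

theorem isProportionallyFair_iff_eq_pfPolicy (hθ : 0 < θ) (hr : ∀ j, 0 < r j) :
    IsProportionallyFair β θ r p ↔ p = pfPolicy β θ r :=
  ⟨fun h => (existsUnique_isProportionallyFair hθ hr).unique h
      (isProportionallyFair_pfPolicy hθ hr),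
    fun h => h ▸ isProportionallyFair_pfPolicy hθ hr⟩

end Objective

/-! ### First-order conditions in terms of interference -/

/-- The probability that a transmission from distance `x` drowns a simultaneous one from
distance `ρ`. -/
noncomputable def interference (x ρ : ℝ) : ℝ := ρ ^ 2 / (ρ ^ 2 + x ^ 2)

theorem one_div_one_add_relDist {N : ℕ} {r : Fin N → ℝ} (hr : ∀ j, 0 < r j) (i j : Fin N) :
    1 / (1 + relDist 2 1 r j i) = interference (r i) (r j) := by
  have h1 := hr i
  have h2 := hr j
  rw [relDist, interference, Real.rpow_ofNat, Real.rpow_ofNat]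
  field_simp

/-- The first-order conditions for the proportionally fair policy, in terms of the total
interference that node `i` causes. -/
theorem pfPolicy_bounds {N : ℕ} {r : Fin N → ℝ} (hr : ∀ j, 0 < r j ∧ r j ≤ 1) (i : Fin N) :
    0 < pfPolicy 2 1 r i ∧ pfPolicy 2 1 r i ≤ 1 ∧
      pfPolicy 2 1 r i * ∑ j ∈ Finset.univ.erase i, interference (r i) (r j) ≤ 1 ∧
      (pfPolicy 2 1 r i < 1 → 1 / pfPolicy 2 1 r i ≤
        ∑ j ∈ Finset.univ.erase i, interference (r i) (r j) +
          ((N : ℝ) - 1) * pfPolicy 2 1 r i / r i ^ 2) := by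
  have hr0 := fun j => (hr j).1
  obtain ⟨hq, hmax⟩ := (isProportionallyFair_iff one_pos hr0).1
    (isProportionallyFair_pfPolicy (β := 2) one_pos hr0) i
  -- Since `r j ≤ 1`, the gap `r i ^ 2` is uniform in `j`, wherever the other nodes lie.
  have ha : ∀ j ∈ Finset.univ.erase i, 1 + r i ^ 2 ≤ 1 + relDist 2 1 r j i := by
    intro j _
    rw [relDist, Real.rpow_ofNat, Real.rpow_ofNat, mul_one, add_le_add_iff_left,
      le_div_iff₀ (pow_pos (hr0 j) 2)]
    exact mul_le_of_le_one_right (sq_nonneg _) (pow_le_one₀ (hr0 j).le (hr j).2)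
  have hc : 0 < r i ^ 2 := pow_pos (hr0 i) 2
  have h1 := mul_sum_le_one_of_isMaxOn (fun j hj => by linarith [ha j hj]) hq hmax
  have h2 := one_div_le_of_isMaxOn hc ha hq hmax
  simp only [one_div_one_add_relDist hr0] at h1 h2
  refine ⟨hq.1, hq.2, h1, fun hlt => ?_⟩
  have hcard : ((Finset.univ.erase i).card : ℝ) = (N : ℝ) - 1 := by
    rw [Finset.card_erase_of_mem (Finset.mem_univ i), Finset.card_univ, Fintype.card_fin,
      Nat.cast_sub (Nat.one_le_of_lt i.isLt), Nat.cast_one]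
  rw [← hcard]
  exact h2 hlt

/-! ### Deterministic comparison of policy error and interference deviation -/

theorem tendsto_succ_rpow_div :
    Tendsto (fun n : ℕ => ((n : ℝ) + 1) ^ (3 / 2 : ℝ) / (n * √n)) atTop (𝓝 1) := by
  have h1 : Tendsto (fun n : ℕ => (1 + 1 / (n : ℝ)) ^ (3 / 2 : ℝ)) atTop (𝓝 1) := by
    have h := (tendsto_one_div_atTop_nhds_zero_nat (𝕜 := ℝ)).const_add 1
    have h' := h.rpow_const (p := 3 / 2) (Or.inl (by norm_num))
    simpa using h'
  refine h1.congr' ?_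
  filter_upwards [eventually_gt_atTop 0] with n hn
  have hn' : (0 : ℝ) < n := by exact_mod_cast hn
  have e1 : (n : ℝ) * √n = (n : ℝ) ^ (3 / 2 : ℝ) := by
    rw [Real.sqrt_eq_rpow, ← Real.rpow_one_add' hn'.le (by norm_num)]
    norm_num
  rw [e1, ← Real.div_rpow (by positivity) hn'.le]
  congr 1
  field_simp

theorem tendsto_one_div_sqrt_natCast : Tendsto (fun n : ℕ => 1 / √(n : ℝ)) atTop (𝓝 0) := by
  simp only [one_div]
  exact tendsto_inv_atTop_zero.comp (Real.tendsto_sqrt_atTop.comp tendsto_natCast_atTop_atTop)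

/-- If the total interference `S` is within `c √n` of its mean `n m`, where `c < m² k`, then for
large `n` a solution `q` of the first-order conditions is within `k / (n + 1) ^ (3 / 2)` of
`1 / (n m)`. -/
theorem eventually_policy_close {m c k x : ℝ} (hm : 0 < m) (hx : 0 < x) (hc : c < m ^ 2 * k) :
    ∀ᶠ n : ℕ in atTop, ∀ S q : ℝ, 0 < q → q ≤ 1 → q * S ≤ 1 →
      (q < 1 → 1 / q ≤ S + n * q / x ^ 2) → |S - n * m| ≤ c * √n →
      |q - 1 / (n * m)| ≤ k / ((n : ℝ) + 1) ^ (3 / 2 : ℝ) := by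
  -- `C` bounds the error `n q / x²`, because `q ≤ 1 / S ≤ 2 / (n m)`.
  set C : ℝ := 2 / (m * x ^ 2) with hC
  have hC0 : 0 < C := by positivity
  -- This is `(n + 1) ^ (3 / 2)` times the final error bound; its limit is `c / m² < k`.
  have hlim : Tendsto (fun n : ℕ => ((n : ℝ) + 1) ^ (3 / 2 : ℝ) / (n * √n) *
      ((c + C * (1 / √n)) / (m * (m - c * (1 / √n))))) atTop
      (𝓝 (1 * ((c + C * 0) / (m * (m - c * 0))))) := by
    refine tendsto_succ_rpow_div.mul (Tendsto.div ?_ ?_ ?_)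
    · exact (tendsto_one_div_sqrt_natCast.const_mul C).const_add c
    · exact ((tendsto_one_div_sqrt_natCast.const_mul c).const_sub m).const_mul m
    · simp [hm.ne']
  have hlt : 1 * ((c + C * 0) / (m * (m - c * 0))) < k := by
    rw [mul_zero, mul_zero, add_zero, sub_zero, one_mul, div_lt_iff₀ (by positivity)]
    linarith
  have hsm : ∀ᶠ n : ℕ in atTop, c * (1 / √n) < m / 2 := by
    have h := tendsto_one_div_sqrt_natCast.const_mul c
    rw [mul_zero] at h
    exact h.eventually_lt_const (by positivity)
  have hbig : ∀ᶠ n : ℕ in atTop, 2 / m < n :=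
    tendsto_natCast_atTop_atTop.eventually_gt_atTop _
  filter_upwards [hlim.eventually_lt_const hlt, hsm, hbig, eventually_gt_atTop 0] with
    n h1 h2 h3 hn S q hq0 hq1 hqS hfo hS
  have hn' : (0 : ℝ) < n := by exact_mod_cast hn
  obtain ⟨s, hs⟩ : ∃ s, √(n : ℝ) = s := ⟨_, rfl⟩
  have hs0 : 0 < s := hs ▸ Real.sqrt_pos.2 hn'
  have hns : (n : ℝ) = s ^ 2 := by rw [← hs, Real.sq_sqrt hn'.le]
  have hR0 : 0 < ((n : ℝ) + 1) ^ (3 / 2 : ℝ) := by positivity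
  obtain ⟨R, hR⟩ : ∃ R, ((n : ℝ) + 1) ^ (3 / 2 : ℝ) = R := ⟨_, rfl⟩
  rw [hs] at h1 h2 hS
  rw [hR] at hR0 h1 ⊢
  rw [hns] at h1 h3 hfo hS ⊢
  have hcs : c * s < s ^ 2 * m / 2 := by
    have := mul_lt_mul_of_pos_right h2 (pow_pos hs0 2)
    field_simp at this ⊢
    linarith
  have hnm : 2 < s ^ 2 * m := by rwa [div_lt_iff₀ hm] at h3
  obtain ⟨hS1, hS2⟩ := abs_le.1 hS
  have hS0 : s ^ 2 * m / 2 < S := by linarith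
  have hSpos : 0 < S := by linarith
  -- The boundary solution `q = 1` would force `S ≤ 1`, but `S > n m / 2 > 1`.
  have hqlt : q < 1 := by
    rcases hq1.lt_or_eq with h | h
    · exact h
    · rw [h] at hqS; linarith
  have hfo' := hfo hqlt
  have hqS' : q ≤ 1 / S := by rwa [le_div_iff₀ hSpos]
  have hE : s ^ 2 * q / x ^ 2 ≤ C := by
    have h : q ≤ 2 / (s ^ 2 * m) := by
      refine hqS'.trans ?_
      rw [div_le_div_iff₀ hSpos (by positivity)]
      linarith
    calc s ^ 2 * q / x ^ 2 ≤ s ^ 2 * (2 / (s ^ 2 * m)) / x ^ 2 := by gcongr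
      _ = C := by rw [hC]; field_simp
  have hSq : S ≤ 1 / q := by rw [le_div_iff₀ hq0]; linarith
  have hden : 0 < s ^ 2 * m - c * s := by linarith
  have habs : |s ^ 2 * m - 1 / q| ≤ c * s + C := by
    rw [abs_le]; constructor <;> linarith
  have hq2 : q ≤ 1 / (s ^ 2 * m - c * s) :=
    hqS'.trans (one_div_le_one_div_of_le hden (by linarith))
  have heq : q - 1 / (s ^ 2 * m) = q * (s ^ 2 * m - 1 / q) / (s ^ 2 * m) := by
    field_simp
  have hcC : 0 ≤ c * s + C := (abs_nonneg _).trans habs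
  rw [heq, abs_div, abs_mul, abs_of_pos hq0, abs_of_pos (by positivity : 0 < s ^ 2 * m)]
  calc q * |s ^ 2 * m - 1 / q| / (s ^ 2 * m)
      ≤ 1 / (s ^ 2 * m - c * s) * (c * s + C) / (s ^ 2 * m) := by gcongr
    _ = R / (s ^ 2 * s) * ((c + C * (1 / s)) / (m * (m - c * (1 / s)))) / R := by
      have e : m - c * (1 / s) = (s ^ 2 * m - c * s) / s ^ 2 := by field_simp
      rw [e]
      field_simp
    _ ≤ k / R := by gcongr

/-- If a solution `q` of the first-order conditions is within `k / (n + 1) ^ (3 / 2)` of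
`1 / (n m)`, then for large `n` the total interference `S` is within `d √n` of its mean `n m`,
for any fixed `d > m² k`. -/
theorem eventually_interference_close {m d k x : ℝ} (hm : 0 < m) (hx : 0 < x)
    (hk : 0 < k) (hd : m ^ 2 * k < d) :
    ∀ᶠ n : ℕ in atTop, ∀ S q : ℝ, 0 < q → q * S ≤ 1 →
      (q < 1 → 1 / q ≤ S + n * q / x ^ 2) →
      |q - 1 / (n * m)| ≤ k / ((n : ℝ) + 1) ^ (3 / 2 : ℝ) → |S - n * m| ≤ d * √n := by
  set C : ℝ := 2 / (m * x ^ 2) with hC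
  set ρ : ℕ → ℝ := fun n => ((n : ℝ) + 1) ^ (3 / 2 : ℝ) / (n * √n) with hρ
  have hρlim : Tendsto (fun n => k / ρ n) atTop (𝓝 (k / 1)) :=
    tendsto_const_nhds.div tendsto_succ_rpow_div one_ne_zero
  have hsmall : Tendsto (fun n : ℕ => k / ρ n * (1 / √n)) atTop (𝓝 (k / 1 * 0)) :=
    hρlim.mul tendsto_one_div_sqrt_natCast
  -- This is the final bound on `|S - n m| / √n`; its limit is `m² k < d`.
  have hlim : Tendsto (fun n : ℕ => k / ρ n * m / (1 / m - k / ρ n * (1 / √n)) + C * (1 / √n)) atTop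
      (𝓝 (k / 1 * m / (1 / m - k / 1 * 0) + C * 0)) := by
    refine Tendsto.add (Tendsto.div (hρlim.mul_const m) (hsmall.const_sub _) ?_)
      (tendsto_one_div_sqrt_natCast.const_mul C)
    simp [hm.ne']
  have hlt : k / 1 * m / (1 / m - k / 1 * 0) + C * 0 < d := by
    refine lt_of_eq_of_lt ?_ hd
    simp
    ring
  -- The error window becomes smaller than half of `1 / (n m)`, so closeness alone yields `q ≤ 2 /
  -- (n m)`.
  have hhalf : ∀ᶠ n : ℕ in atTop, k / ρ n * (1 / √n) < 1 / (2 * m) :=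
    hsmall.eventually_lt_const (by rw [mul_zero]; positivity)
  have hbig : ∀ᶠ n : ℕ in atTop, 2 / m < n :=
    tendsto_natCast_atTop_atTop.eventually_gt_atTop _
  filter_upwards [hlim.eventually_lt_const hlt, hhalf, hbig, eventually_gt_atTop 0] with
    n h1 h2 h3 hn S q hq0 hqS hfo hclose
  have hn' : (0 : ℝ) < n := by exact_mod_cast hn
  obtain ⟨s, hs⟩ : ∃ s, √(n : ℝ) = s := ⟨_, rfl⟩
  have hs0 : 0 < s := hs ▸ Real.sqrt_pos.2 hn'
  have hns : (n : ℝ) = s ^ 2 := by rw [← hs, Real.sq_sqrt hn'.le]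
  have hR0 : 0 < ((n : ℝ) + 1) ^ (3 / 2 : ℝ) := by positivity
  have hκ : k / ((n : ℝ) + 1) ^ (3 / 2 : ℝ) = k / ρ n * (1 / s) / s ^ 2 := by
    simp only [hρ, hs]
    rw [← hns]
    field_simp
  rw [hκ] at hclose
  rw [hs] at h1 h2 ⊢
  have hu0 : 0 < k / ρ n := by
    simp only [hρ]
    rw [hs]
    positivity
  obtain ⟨u, hu⟩ : ∃ u, k / ρ n = u := ⟨_, rfl⟩
  rw [hu] at h1 h2 hclose hu0
  rw [hns] at h3 hfo hclose ⊢
  have hnm : 2 < s ^ 2 * m := by rwa [div_lt_iff₀ hm] at h3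
  obtain ⟨hc1, hc2⟩ := abs_le.1 hclose
  have hκτ : u * (1 / s) / s ^ 2 < 1 / (2 * m) / s ^ 2 := by gcongr
  have hτ : 1 / (s ^ 2 * m) = 1 / m / s ^ 2 := by field_simp
  have hhalf' : 1 / (2 * m) / s ^ 2 = 1 / m / s ^ 2 / 2 := by field_simp
  have hq2 : q ≤ 2 * (1 / (s ^ 2 * m)) := by
    have : 0 < 1 / m / s ^ 2 := by positivity
    linarith
  have hqlt : q < 1 := by
    refine hq2.trans_lt ?_
    rw [mul_one_div, div_lt_one (by positivity)]
    exact hnm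
  have hfo' := hfo hqlt
  have hE : s ^ 2 * q / x ^ 2 ≤ C := by
    calc s ^ 2 * q / x ^ 2 ≤ s ^ 2 * (2 * (1 / (s ^ 2 * m))) / x ^ 2 := by gcongr
      _ = C := by rw [hC]; field_simp
  have hSq : S ≤ 1 / q := by rw [le_div_iff₀ hq0]; linarith
  have hgap : 0 < 1 / m - u * (1 / s) := by
    have : 1 / (2 * m) = 1 / m / 2 := by field_simp
    have : 0 < 1 / m := by positivity
    linarith
  have hql : (1 / m - u * (1 / s)) / s ^ 2 ≤ q := by
    rw [sub_div]
    linarith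
  have hmain : |1 / q - s ^ 2 * m| ≤ s * (u * m / (1 / m - u * (1 / s))) := by
    have e : 1 / q - s ^ 2 * m = -(q - 1 / (s ^ 2 * m)) * (s ^ 2 * m) / q := by
      field_simp
      ring
    rw [e, abs_div, abs_mul, abs_neg, abs_of_pos hq0,
      abs_of_pos (by positivity : 0 < s ^ 2 * m)]
    calc |q - 1 / (s ^ 2 * m)| * (s ^ 2 * m) / q
        ≤ u * (1 / s) / s ^ 2 * (s ^ 2 * m) / ((1 / m - u * (1 / s)) / s ^ 2) := by gcongr
      _ = s * (u * m / (1 / m - u * (1 / s))) := by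
        obtain ⟨g, hg⟩ : ∃ g, 1 / m - u * (1 / s) = g := ⟨_, rfl⟩
        rw [hg] at hgap ⊢
        field_simp
  have hds : s * (u * m / (1 / m - u * (1 / s))) + C ≤ d * s := by
    have h := mul_lt_mul_of_pos_right h1 hs0
    have e : C * (1 / s) * s = C := by field_simp
    rw [add_mul, e] at h
    linarith
  have hCx : 0 ≤ C := by positivity
  rw [abs_le] at hmain ⊢
  constructor <;> linarith [hmain.1, hmain.2]

/-! ### The uniform law on the disc and the moments of the interference -/

instance : IsProbabilityMeasure uniformDisc := by
  refine cond_isProbabilityMeasure_of_finite ?_ ?_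
  · exact (Metric.measure_closedBall_pos volume _ one_pos).ne'
  · exact measure_closedBall_lt_top.ne

instance (N : ℕ) : IsProbabilityMeasure (locationLaw N) := by
  unfold locationLaw; infer_instance

theorem uniformDisc_absolutelyContinuous : uniformDisc ≪ volume :=
  cond_absolutelyContinuous

theorem ae_norm_mem_Ioc_uniformDisc : ∀ᵐ y ∂uniformDisc, 0 < ‖y‖ ∧ ‖y‖ ≤ 1 := by
  have h1 : ∀ᵐ y ∂uniformDisc, y ∈ Metric.closedBall (0 : EuclideanSpace ℝ (Fin 2)) 1 :=
    ae_cond_mem measurableSet_closedBall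
  have h2 : ∀ᵐ y ∂uniformDisc, y ≠ 0 :=
    uniformDisc_absolutelyContinuous.ae_le (Measure.ae_ne volume 0)
  filter_upwards [h1, h2] with y hy hy'
  exact ⟨norm_pos_iff.2 hy', by simpa using hy⟩

theorem ae_norm_mem_Ioc_locationLaw (N : ℕ) :
    ∀ᵐ y ∂locationLaw N, ∀ j, 0 < ‖y j‖ ∧ ‖y j‖ ≤ 1 :=
  ae_all_iff.2 fun j =>
    (measurePreserving_eval (fun _ : Fin N => uniformDisc) j).quasiMeasurePreserving.ae
      ae_norm_mem_Ioc_uniformDisc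

/-- Under the uniform distribution on the disc, the distance to the centre has density `2 ρ`. -/
theorem integral_norm_uniformDisc (f : ℝ → ℝ) :
    ∫ y, f ‖y‖ ∂uniformDisc = 2 * ∫ ρ in (0 : ℝ)..1, ρ * f ρ := by
  have hvol : volume.real (Metric.closedBall (0 : EuclideanSpace ℝ (Fin 2)) 1) =
      volume.real (Metric.ball (0 : EuclideanSpace ℝ (Fin 2)) 1) := by
    rw [Measure.real, Measure.real, Measure.addHaar_closedBall_eq_addHaar_ball]
  have hpos : 0 < volume.real (Metric.ball (0 : EuclideanSpace ℝ (Fin 2)) 1) :=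
    ENNReal.toReal_pos (Metric.measure_ball_pos volume _ one_pos).ne' measure_ball_lt_top.ne
  have hind : ∫ y in Metric.closedBall (0 : EuclideanSpace ℝ (Fin 2)) 1, f ‖y‖ =
      ∫ y : EuclideanSpace ℝ (Fin 2), (Set.Iic (1 : ℝ)).indicator f ‖y‖ := by
    rw [← integral_indicator measurableSet_closedBall]
    congr 1
    ext y
    by_cases hy : ‖y‖ ≤ 1 <;> simp [Set.indicator, hy]
  have hrad : ∫ ρ in Set.Ioi (0 : ℝ), ρ * (Set.Iic (1 : ℝ)).indicator f ρ =
      ∫ ρ in (0 : ℝ)..1, ρ * f ρ := by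
    have h : (fun ρ : ℝ => ρ * (Set.Iic (1 : ℝ)).indicator f ρ) =
        (Set.Iic (1 : ℝ)).indicator fun ρ => ρ * f ρ := by
      ext ρ
      simp [Set.indicator_apply]
    rw [h, setIntegral_indicator measurableSet_Iic, Set.Ioi_inter_Iic,
      intervalIntegral.integral_of_le zero_le_one]
  rw [uniformDisc, ProbabilityTheory.cond, integral_smul_measure, hind,
    integral_fun_norm_addHaar volume (Set.indicator (Set.Iic (1 : ℝ)) f)]
  simp only [finrank_euclideanSpace, Fintype.card_fin, Nat.add_one_sub_one, pow_one, smul_eq_mul,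
    nsmul_eq_mul, hrad, ENNReal.toReal_inv]
  change (volume.real _)⁻¹ * _ = _
  rw [hvol]
  field_simp
  norm_num [mul_comm]

/-- The mean interference that a node at distance `x` causes to a uniformly located node. -/
noncomputable def meanInterference (x : ℝ) : ℝ := 1 - x ^ 2 * Real.log (1 + 1 / x ^ 2)

theorem meanInterference_pos {x : ℝ} (hx : 0 < x) : 0 < meanInterference x := by
  have h : Real.log (1 + 1 / x ^ 2) < 1 / x ^ 2 := by
    have h1 : 0 < 1 / x ^ 2 := by positivity
    have h2 := Real.log_lt_sub_one_of_pos (x := 1 + 1 / x ^ 2) (by positivity) (by linarith)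
    linarith
  have h2 := mul_lt_mul_of_pos_left h (pow_pos hx 2)
  rw [mul_one_div_cancel (pow_pos hx 2).ne'] at h2
  unfold meanInterference
  linarith

/-- From `ρ³ / (ρ² + x²) = ρ - x² ρ / (ρ² + x²)` one reads off the antiderivative. -/
theorem integral_interference {x : ℝ} (hx : 0 < x) :
    ∫ y, interference x ‖y‖ ∂uniformDisc = meanInterference x := by
  rw [integral_norm_uniformDisc]
  have hden : ∀ ρ : ℝ, 0 < ρ ^ 2 + x ^ 2 := fun ρ => by positivity
  have hderiv : ∀ ρ ∈ Set.uIcc (0 : ℝ) 1,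
      HasDerivAt (fun ρ : ℝ => (ρ ^ 2 - x ^ 2 * Real.log (ρ ^ 2 + x ^ 2)) / 2)
        (ρ * interference x ρ) ρ := by
    intro ρ _
    have h1 : HasDerivAt (fun ρ : ℝ => ρ ^ 2) (2 * ρ) ρ := by simpa using hasDerivAt_pow 2 ρ
    have h2 := (h1.sub (((h1.add_const (x ^ 2)).log (hden ρ).ne').const_mul (x ^ 2))).div_const 2
    refine h2.congr_deriv ?_
    have := (hden ρ).ne'
    rw [interference]
    field_simp
    ring
  have hcont : Continuous fun ρ : ℝ => ρ * interference x ρ := by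
    unfold interference
    exact continuous_id.mul ((continuous_id.pow 2).div ((continuous_id.pow 2).add continuous_const)
      fun ρ => (hden ρ).ne')
  rw [intervalIntegral.integral_eq_sub_of_hasDerivAt hderiv (hcont.intervalIntegrable _ _),
    meanInterference]
  have e : 1 + 1 / x ^ 2 = (1 ^ 2 + x ^ 2) / x ^ 2 := by field_simp; ring
  rw [e, Real.log_div (hden 1).ne' (pow_pos hx 2).ne']
  simp
  ring

theorem measurable_interference (x : ℝ) :
    Measurable fun y : EuclideanSpace ℝ (Fin 2) => interference x ‖y‖ := by
  unfold interference; fun_prop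

theorem measurable_sum_interference {ι : Type*} (s : Finset ι) (x : ℝ) :
    Measurable fun y : ι → EuclideanSpace ℝ (Fin 2) => ∑ j ∈ s, interference x ‖y j‖ :=
  Finset.measurable_fun_sum _ fun j _ => (measurable_interference x).comp (measurable_pi_apply j)

theorem memLp_interference (x : ℝ) :
    MemLp (fun y : EuclideanSpace ℝ (Fin 2) => interference x ‖y‖) 2 uniformDisc := by
  refine MemLp.of_bound (measurable_interference x).aestronglyMeasurable 1 (ae_of_all _ fun y => ?_)
  rw [interference, Real.norm_of_nonneg (by positivity)]
  exact div_le_one_of_le₀ (le_add_of_nonneg_right (sq_nonneg x)) (by positivity)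

/-- Zero variance would make the interference, hence the norm, almost surely constant, but circles
are null. Nondegeneracy gives the Gaussian limit a density. -/
theorem variance_interference_ne_zero {x : ℝ} (hx : 0 < x) :
    Var[fun y => interference x ‖y‖; uniformDisc] ≠ 0 := by
  intro h
  have h1 := ae_eq_integral_of_variance_eq_zero (memLp_interference x) h
  rw [integral_interference hx] at h1
  have h2 : ∀ c : ℝ, ∀ᵐ y ∂uniformDisc, ‖y‖ ≠ c := by
    intro c
    refine uniformDisc_absolutelyContinuous.ae_le ?_
    have := Measure.addHaar_sphere (volume : Measure (EuclideanSpace ℝ (Fin 2))) 0 c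
    change _ = _
    convert this using 2
    ext y
    simp
  have h3 : ∀ᵐ y ∂uniformDisc, False := by
    filter_upwards [h1, h2 √(meanInterference x * x ^ 2 / (1 - meanInterference x))] with y hy hy'
    apply hy'
    have hd : 0 < ‖y‖ ^ 2 + x ^ 2 := by positivity
    rw [interference, div_eq_iff hd.ne'] at hy
    have hne : 1 - meanInterference x ≠ 0 := by
      intro h0
      have : meanInterference x = 1 := by linarith
      rw [this] at hy
      nlinarith [pow_pos hx 2]
    have hsq : meanInterference x * x ^ 2 / (1 - meanInterference x) = ‖y‖ ^ 2 := by
      rw [div_eq_iff hne]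
      linarith
    rw [hsq, Real.sqrt_sq (norm_nonneg y)]
  exact (IsProbabilityMeasure.ne_zero uniformDisc) (by simpa using h3)

/-! ### Central limit theorem for the total interference -/

/-- Moves the sums for all `n` and `i` to a single iid sequence, as the central limit theorem needs;
both characteristic functions are the same `n`-th power. That `i` disappears is the source of
uniformity in the node. -/
theorem map_sum_interference {n : ℕ} (i : Fin (n + 1)) (x : ℝ) :
    (locationLaw (n + 1)).map (fun y => ∑ j ∈ Finset.univ.erase i, interference x ‖y j‖) =
      (Measure.infinitePi fun _ : ℕ => uniformDisc).map
        (fun ω => ∑ k ∈ Finset.range n, interference x ‖ω k‖) := by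
  have hf := measurable_interference x
  have := Measure.isProbabilityMeasure_map (μ := locationLaw (n + 1))
    (measurable_sum_interference (Finset.univ.erase i) x).aemeasurable
  have := Measure.isProbabilityMeasure_map (μ := Measure.infinitePi fun _ : ℕ => uniformDisc)
    (measurable_sum_interference (Finset.range n) x).aemeasurable
  refine Measure.ext_of_charFun ?_
  have hi1 : iIndepFun (fun (j : Fin (n + 1)) (y : Fin (n + 1) → EuclideanSpace ℝ (Fin 2)) =>
      interference x ‖y j‖) (locationLaw (n + 1)) :=
    iIndepFun_pi (X := fun (_ : Fin (n + 1)) (y : EuclideanSpace ℝ (Fin 2)) => interference x ‖y‖)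
      (μ := fun _ => uniformDisc) fun _ => hf.aemeasurable
  have hi2 : iIndepFun (fun (k : ℕ) (ω : ℕ → EuclideanSpace ℝ (Fin 2)) =>
      interference x ‖ω k‖) (Measure.infinitePi fun _ : ℕ => uniformDisc) :=
    iIndepFun_infinitePi (X := fun (_ : ℕ) (y : EuclideanSpace ℝ (Fin 2)) => interference x ‖y‖)
      fun _ => hf
  have hm1 : ∀ j, (locationLaw (n + 1)).map (fun y => interference x ‖y j‖) =
      uniformDisc.map fun y => interference x ‖y‖ := by
    intro j
    conv_rhs => rw [← (measurePreserving_eval (fun _ : Fin (n + 1) => uniformDisc) j).map_eq,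
      Measure.map_map hf (measurable_pi_apply j)]
    rfl
  have hm2 : ∀ k, (Measure.infinitePi fun _ : ℕ => uniformDisc).map
      (fun ω => interference x ‖ω k‖) = uniformDisc.map fun y => interference x ‖y‖ := by
    intro k
    conv_rhs => rw [← (measurePreserving_eval_infinitePi (fun _ : ℕ => uniformDisc) k).map_eq,
      Measure.map_map hf (measurable_pi_apply k)]
    rfl
  have h1 := (hi1.restrict (Finset.univ.erase i)).charFun_map_fun_finsetSum_eq_prod fun j _ =>
    (hf.comp (measurable_pi_apply j)).aemeasurable
  have h2 := (hi2.restrict (Finset.range n)).charFun_map_fun_finsetSum_eq_prod fun j _ =>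
    (hf.comp (measurable_pi_apply j)).aemeasurable
  refine h1.trans (Eq.trans ?_ h2.symm)
  simp only [Function.comp_def, hm1, hm2, Finset.prod_const]
  simp

/-- The limiting distribution of the normalized total interference. -/
noncomputable def limitLaw (x : ℝ) : Measure ℝ :=
  gaussianReal 0 Var[fun y => interference x ‖y‖; uniformDisc].toNNReal

instance (x : ℝ) : IsProbabilityMeasure (limitLaw x) := by
  unfold limitLaw; infer_instance

theorem toNNReal_variance_interference_ne_zero {x : ℝ} (hx : 0 < x) :
    Var[fun y => interference x ‖y‖; uniformDisc].toNNReal ≠ 0 :=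
  (Real.toNNReal_pos.2 ((variance_nonneg _ _).lt_of_ne
    (variance_interference_ne_zero hx).symm)).ne'

theorem nullSingletonClass_limitLaw {x : ℝ} (hx : 0 < x) : NullSingletonClass (limitLaw x) :=
  nullSingletonClass_gaussianReal (toNNReal_variance_interference_ne_zero hx)

/-- The probability that the total interference deviates from its mean by at most `c √n`. -/
noncomputable def deviationProb (x c : ℝ) (n : ℕ) : ℝ :=
  (Measure.infinitePi fun _ : ℕ => uniformDisc).real
    {ω | |∑ k ∈ Finset.range n, interference x ‖ω k‖ - n * meanInterference x| ≤ c * √n}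

theorem locationLaw_real_deviation {n : ℕ} (i : Fin (n + 1)) (x c : ℝ) :
    (locationLaw (n + 1)).real {y | |∑ j ∈ Finset.univ.erase i, interference x ‖y j‖ -
      n * meanInterference x| ≤ c * √n} = deviationProb x c n := by
  have hs : MeasurableSet {u : ℝ | |u - n * meanInterference x| ≤ c * √n} :=
    measurableSet_le (by fun_prop) measurable_const
  have h := congrArg (fun μ : Measure ℝ => μ.real {u : ℝ | |u - n * meanInterference x| ≤ c * √n})
    (map_sum_interference i x)
  rwa [map_measureReal_apply (measurable_sum_interference _ x) hs,
    map_measureReal_apply (measurable_sum_interference _ x) hs] at h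

theorem tendsto_deviationProb {x : ℝ} (hx : 0 < x) (c : ℝ) :
    Tendsto (deviationProb x c) atTop (𝓝 ((limitLaw x).real (Set.Icc (-c) c))) := by
  have hf := measurable_interference x
  set P := Measure.infinitePi fun _ : ℕ => uniformDisc
  set X : ℕ → (ℕ → EuclideanSpace ℝ (Fin 2)) → ℝ := fun k ω => interference x ‖ω k‖
  have hmp := fun k : ℕ => measurePreserving_eval_infinitePi (fun _ : ℕ => uniformDisc) k
  have hid : ∀ k, IdentDistrib (X k) (fun y => interference x ‖y‖) P uniformDisc := fun k =>
    ⟨(hf.comp (measurable_pi_apply k)).aemeasurable, hf.aemeasurable, by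
      rw [← (hmp k).map_eq, Measure.map_map hf (measurable_pi_apply k)]; rfl⟩
  have hmean : P[X 0] = meanInterference x := by
    rw [(hid 0).integral_eq, integral_interference hx]
  have hvar : Var[X 0; P] = Var[fun y => interference x ‖y‖; uniformDisc] := (hid 0).variance_eq
  have hclt := tendstoInDistribution_inv_sqrt_mul_sum_sub (X := X) (P := P) (P' := limitLaw x)
    (Y := id) (by rw [hvar]; exact ⟨aemeasurable_id, Measure.map_id⟩)
    ((hid 0).memLp_iff.2 (memLp_interference x))
    (iIndepFun_infinitePi (X := fun (_ : ℕ) (y : EuclideanSpace ℝ (Fin 2)) => interference x ‖y‖)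
      fun _ => hf) fun k => (hid k).trans (hid 0).symm
  have := nullSingletonClass_limitLaw hx
  -- Convergence in distribution passes to the interval because the limit has no atoms at `±c`.
  have hfr : (limitLaw x).map id (frontier (Set.Icc (-c) c)) = 0 := by
    rw [Measure.map_id]
    refine measure_mono_null (t := {-c, c}) ?_ ((Set.toFinite _).measure_zero _)
    rcases le_or_gt (-c) c with h | h
    · rw [frontier_Icc h]
    · rw [Set.Icc_eq_empty (not_le.2 h)]; simp
  have hlim := ProbabilityMeasure.tendsto_measure_of_null_frontier_of_tendsto' hclt.tendsto hfr
  simp only [ProbabilityMeasure.coe_mk, Measure.map_id] at hlim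
  have hlim' := (ENNReal.tendsto_toReal (measure_ne_top _ _)).comp hlim
  refine hlim'.congr' ?_
  filter_upwards [eventually_gt_atTop 0] with n hn
  have hs : 0 < √(n : ℝ) := Real.sqrt_pos.2 (by exact_mod_cast hn)
  rw [Function.comp_apply, deviationProb,
    Measure.map_apply_of_aemeasurable (hclt.forall_aemeasurable n) measurableSet_Icc,
    Measure.real]
  congr 2
  ext ω
  simp only [Set.mem_preimage, Set.mem_Icc, Set.mem_ofPred_eq, ← abs_le, hmean]
  rw [abs_mul, abs_of_pos (inv_pos.2 hs), inv_mul_le_iff₀ hs, mul_comm (√(n : ℝ)) c]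

/-- The probability that the limiting distribution assigns to `[-c, c]`, as a signed integral of
the density. -/
noncomputable def limitMass (x c : ℝ) : ℝ :=
  ∫ t in (-c)..c, gaussianPDFReal 0 Var[fun y => interference x ‖y‖; uniformDisc].toNNReal t

theorem limitLaw_real_Icc {x c : ℝ} (hx : 0 < x) (hc : 0 ≤ c) :
    (limitLaw x).real (Set.Icc (-c) c) = limitMass x c := by
  rw [Measure.real, limitLaw,
    gaussianReal_apply_eq_integral _ (toNNReal_variance_interference_ne_zero hx),
    ENNReal.toReal_ofReal (integral_nonneg fun t => gaussianPDFReal_nonneg _ _ t), limitMass,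
    intervalIntegral.integral_of_le (by linarith), integral_Icc_eq_integral_Ioc]

theorem continuous_limitMass (x : ℝ) : Continuous (limitMass x) := by
  have hpdf : ∀ a b : ℝ, IntervalIntegrable
      (gaussianPDFReal 0 Var[fun y => interference x ‖y‖; uniformDisc].toNNReal) volume a b :=
    fun a b => (integrable_gaussianPDFReal _ _).intervalIntegrable
  have hp := intervalIntegral.continuous_primitive hpdf 0
  have h : limitMass x = fun c => (∫ t in (0 : ℝ)..c, gaussianPDFReal 0
        Var[fun y => interference x ‖y‖; uniformDisc].toNNReal t) -
      ∫ t in (0 : ℝ)..(-c), gaussianPDFReal 0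
        Var[fun y => interference x ‖y‖; uniformDisc].toNNReal t := by
    ext c
    exact (intervalIntegral.integral_interval_sub_left (hpdf _ _) (hpdf _ _)).symm
  rw [h]
  exact hp.sub (hp.comp continuous_neg)

theorem tendsto_limitMass {x : ℝ} (hx : 0 < x) : Tendsto (limitMass x) atTop (𝓝 1) := by
  rw [← integral_gaussianPDFReal_eq_one 0 (toNNReal_variance_interference_ne_zero hx)]
  exact intervalIntegral_tendsto_integral (integrable_gaussianPDFReal _ _)
    tendsto_neg_atTop_atBot tendsto_id

theorem exists_limitMass_eq {x ε : ℝ} (hx : 0 < x) (hε : 0 < ε) (hε1 : ε < 1) :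
    ∃ c, 0 < c ∧ limitMass x c = 1 - ε := by
  obtain ⟨b, hb, hb0⟩ := (((tendsto_limitMass hx).eventually_const_lt
    (by linarith : 1 - ε < 1)).and (eventually_ge_atTop 0)).exists
  have h0 : limitMass x 0 = 0 := by simp [limitMass]
  obtain ⟨c, hc, hceq⟩ := intermediate_value_Icc hb0 (continuous_limitMass x).continuousOn
    (show 1 - ε ∈ Set.Icc (limitMass x 0) (limitMass x b) from ⟨by linarith, hb.le⟩)
  refine ⟨c, lt_of_le_of_ne hc.1 ?_, hceq⟩
  rintro rfl
  linarith

/-! ### Transfer to the closeness probabilities -/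

theorem sum_interference_positions {N : ℕ} (i : Fin N) (x : ℝ)
    (y : Fin N → EuclideanSpace ℝ (Fin 2)) :
    ∑ j ∈ Finset.univ.erase i, interference (positions i x y i) (positions i x y j) =
      ∑ j ∈ Finset.univ.erase i, interference x ‖y j‖ := by
  refine Finset.sum_congr rfl fun j hj => ?_
  rw [positions, Function.update_self, Function.update_of_ne (Finset.ne_of_mem_erase hj)]

/-- The first-order conditions for a node at distance `x` hold almost surely. -/
theorem ae_pfPolicy_bounds {n : ℕ} (i : Fin (n + 1)) {x : ℝ} (hx : 0 < x) (hx1 : x ≤ 1) :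
    ∀ᵐ y ∂locationLaw (n + 1), 0 < pfPolicy 2 1 (positions i x y) i ∧
      pfPolicy 2 1 (positions i x y) i ≤ 1 ∧
      pfPolicy 2 1 (positions i x y) i *
        ∑ j ∈ Finset.univ.erase i, interference x ‖y j‖ ≤ 1 ∧
      (pfPolicy 2 1 (positions i x y) i < 1 → 1 / pfPolicy 2 1 (positions i x y) i ≤
        ∑ j ∈ Finset.univ.erase i, interference x ‖y j‖ +
          n * pfPolicy 2 1 (positions i x y) i / x ^ 2) := by
  filter_upwards [ae_norm_mem_Ioc_locationLaw (n + 1)] with y hy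
  have hr : ∀ j, 0 < positions i x y j ∧ positions i x y j ≤ 1 := by
    intro j
    rcases eq_or_ne j i with rfl | h
    · simpa [positions] using ⟨hx, hx1⟩
    · simpa [positions, h] using hy j
  have h := pfPolicy_bounds hr i
  have hi : positions i x y i = x := by simp [positions]
  rw [sum_interference_positions, hi] at h
  simpa using h

theorem taProb_succ (n : ℕ) (x : ℝ) : taProb (n + 1) x = 1 / (n * meanInterference x) := by
  simp [taProb, meanInterference]

/-- Monotonicity of measure under almost sure inclusion suffices, so measurability of `pfPolicy` is
never needed. -/
theorem eventually_deviationProb_le_closenessProb {x c k : ℝ} (hx : 0 < x) (hx1 : x ≤ 1)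
    (hc : c < meanInterference x ^ 2 * k) :
    ∀ᶠ n : ℕ in atTop, ∀ i : Fin (n + 1),
      deviationProb x c n ≤ closenessProb (n + 1) i x k := by
  filter_upwards [eventually_policy_close (meanInterference_pos hx) hx hc] with n hn i
  rw [← locationLaw_real_deviation i, closenessProb]
  refine ENNReal.toReal_mono (measure_ne_top _ _) (measure_mono_ae ?_)
  filter_upwards [ae_pfPolicy_bounds i hx hx1] with y ⟨h0, h1, h2, h3⟩ hS
  have := hn _ _ h0 h1 h2 h3 hS
  change |_ - _| ≤ _
  rw [taProb_succ]
  exact_mod_cast this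

theorem eventually_closenessProb_le_deviationProb {x d k : ℝ} (hx : 0 < x) (hx1 : x ≤ 1)
    (hk : 0 < k) (hd : meanInterference x ^ 2 * k < d) :
    ∀ᶠ n : ℕ in atTop, ∀ i : Fin (n + 1),
      closenessProb (n + 1) i x k ≤ deviationProb x d n := by
  filter_upwards [eventually_interference_close (meanInterference_pos hx) hx hk hd] with n hn i
  rw [← locationLaw_real_deviation i, closenessProb]
  refine ENNReal.toReal_mono (measure_ne_top _ _) (measure_mono_ae ?_)
  filter_upwards [ae_pfPolicy_bounds i hx hx1] with y ⟨h0, _, h2, h3⟩ hq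
  refine hn _ _ h0 h2 h3 ?_
  change |_ - _| ≤ _ at hq
  rw [taProb_succ] at hq
  exact_mod_cast hq

/-- The closeness probabilities converge, uniformly over the nodes, to the Gaussian limit. -/
theorem exists_forall_abs_closenessProb_sub_lt {x k δ : ℝ} (hx : 0 < x) (hx1 : x ≤ 1)
    (hk : 0 < k) (hδ : 0 < δ) :
    ∃ N₀ : ℕ, ∀ N : ℕ, N₀ ≤ N → ∀ i : Fin N,
      |closenessProb N i x k - limitMass x (meanInterference x ^ 2 * k)| < δ := by
  set c := meanInterference x ^ 2 * k with hc
  have hc0 : 0 < c := mul_pos (pow_pos (meanInterference_pos hx) 2) hk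
  obtain ⟨η, hη, hcont⟩ := Metric.continuous_iff.1 (continuous_limitMass x) c (δ / 2) (half_pos hδ)
  -- Below `η` for continuity of the mass, and at most `c` so that `c - h ≥ 0`, as
  -- `limitLaw_real_Icc` requires.
  set h := min (η / 2) c with hh
  have hh0 : 0 < h := lt_min (half_pos hη) hc0
  have hhη : h < η := (min_le_left _ _).trans_lt (half_lt_self hη)
  have hhc : h ≤ c := min_le_right _ _
  have hlow := hcont (c - h) (by rwa [Real.dist_eq, sub_sub_cancel_left, abs_neg, abs_of_pos hh0])
  have hupp := hcont (c + h) (by rwa [Real.dist_eq, add_sub_cancel_left, abs_of_pos hh0])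
  rw [Real.dist_eq, abs_lt] at hlow hupp
  have hl := tendsto_deviationProb hx (c - h)
  have hu := tendsto_deviationProb hx (c + h)
  rw [limitLaw_real_Icc hx (by linarith)] at hl hu
  have hev := (hl.eventually_const_lt (sub_lt_self _ (half_pos hδ))).and
    ((hu.eventually_lt_const (lt_add_of_pos_right _ (half_pos hδ))).and
    ((eventually_deviationProb_le_closenessProb hx hx1 (sub_lt_self c hh0)).and
      (eventually_closenessProb_le_deviationProb hx hx1 hk (lt_add_of_pos_right c hh0))))
  obtain ⟨n₀, hn₀⟩ := eventually_atTop.1 hev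
  refine ⟨n₀ + 1, fun N hN => ?_⟩
  obtain ⟨n, rfl⟩ : ∃ n, N = n + 1 := ⟨N - 1, by omega⟩
  intro i
  obtain ⟨h1, h2, h3, h4⟩ := hn₀ n (by omega)
  have h3i := h3 i
  have h4i := h4 i
  rw [abs_lt]
  constructor <;> linarith [hlow.1, hlow.2, hupp.1, hupp.2]

/-- With a suitable constant, the closeness probabilities converge to `1 - ε`. -/
theorem exists_closenessProb_tendsto {x ε : ℝ} (hx : 0 < x) (hx1 : x ≤ 1) (hε : 0 < ε)
    (hε1 : ε < 1) :
    ∃ k : ℝ, 0 < k ∧ ∀ δ : ℝ, 0 < δ → ∃ N₀ : ℕ, ∀ N : ℕ, N₀ ≤ N → ∀ i : Fin N,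
      |closenessProb N i x k - (1 - ε)| < δ := by
  obtain ⟨c, hc, hceq⟩ := exists_limitMass_eq hx hε hε1
  have hm : 0 < meanInterference x ^ 2 := pow_pos (meanInterference_pos hx) 2
  refine ⟨c / meanInterference x ^ 2, div_pos hc hm, fun δ hδ => ?_⟩
  have h := exists_forall_abs_closenessProb_sub_lt hx hx1 (div_pos hc hm) hδ
  rwa [mul_div_cancel₀ _ hm.ne', hceq] at h

end SpatialAoI

theorem theorem7 :
    -- the proportionally fair policy is well defined: it is the unique minimizer
    (∀ (N : ℕ) (r : Fin N → ℝ), (∀ j, 0 < r j ∧ r j ≤ 1) →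
      ∀ p : Fin N → ℝ, SpatialAoI.IsProportionallyFair 2 1 r p ↔ p = SpatialAoI.pfPolicy 2 1 r) ∧
    ∀ x : ℝ, 0 < x → x ≤ 1 →
      -- the probability of being within `k / N ^ (3 / 2)` tends to `1 - ε`, uniformly in the node
      (∀ ε : ℝ, 0 < ε → ε < 1 → ∃ k : ℝ, 0 < k ∧
        ∀ δ : ℝ, 0 < δ → ∃ N₀ : ℕ, ∀ N : ℕ, N₀ ≤ N → ∀ i : Fin N,
          |SpatialAoI.closenessProb N i x k - (1 - ε)| < δ) ∧
      -- it is at least `1 - ε` for all large `N`, for a suitable constant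
      (∀ ε : ℝ, 0 < ε → ∃ k : ℝ, 0 < k ∧
        ∃ N₀ : ℕ, ∀ N : ℕ, N₀ ≤ N → ∀ i : Fin N,
          1 - ε ≤ SpatialAoI.closenessProb N i x k) := by
  refine ⟨fun N r hr p => SpatialAoI.isProportionallyFair_iff_eq_pfPolicy one_pos fun j => (hr j).1,
    fun x hx hx1 => ⟨fun ε hε hε1 => SpatialAoI.exists_closenessProb_tendsto hx hx1 hε hε1,
      fun ε hε => ?_⟩⟩
  -- The minimum with `1 / 2` covers `ε ≥ 1`; the other half of `ε` absorbs the convergence error.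
  obtain ⟨k, hk, h⟩ := SpatialAoI.exists_closenessProb_tendsto (ε := min (ε / 2) (1 / 2)) hx hx1
    (by positivity) ((min_le_right _ _).trans_lt (by norm_num))
  obtain ⟨N₀, hN₀⟩ := h (ε / 2) (half_pos hε)
  refine ⟨k, hk, N₀, fun N hN i => ?_⟩
  have h1 := (abs_lt.1 (hN₀ N hN i)).1
  have h2 := min_le_left (ε / 2) (1 / 2)
  linarith
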